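/- Let $(V,E)$ be an infinite, locally finite, connected graph. Let each edge $xy\in E$ carry real numbers $R_{xy},L_{xy},D_{xy}\ge 0$ (resistance, inductance, inverse capacitance) with $R_{xy}+L_{xy}+D_{xy}>0$, and for $\lambda\in\mathbb C\setminus\{0\}$ let $z_{xy}^{(\lambda)}=R_{xy}+L_{xy}\lambda+D_{xy}/\lambda$ be its impedance. Let $\Lambda$ be the set of all $\lambda\in\mathbb{C}\setminus\{0\}$ with $z_{xy}^{(\lambda)}\ne0$ for all $xy\in E$; for $\lambda\in\Lambda$ put $\rho_{xy}=\rho_{xy}^{(\lambda)}=1/z_{xy}^{(\lambda)}$ if $xy\in E$ and $\rho_{xy}=0$ otherwise. Fix a vertex $a\in V$ and a (possibly empty) set $B\subset V$ with $a\notin B$. For $n\ge 1$ let $V_n=\{x\in V:\operatorname{dist}(a,x)\le n\}$, $\partial V_n=\{x\in V:\operatorname{dist}(a,x)=n\}$, where $\operatorname{dist}$ is the graph distance, and $B_n=(B\cap V_n)\cup\partial V_n$. For $\lambda\in\Lambda$ the partial effective admittance is $$\mathcal P_n(\lambda)=\sum_{x\in V_n}(1-v(x))\,\rho_{xa}^{(\lambda)}\in\mathbb{C},$$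 where $v:V_n\to\mathbb C$ is any solution of the Dirichlet problem $$\sum_{y\in V_n}(v(y)-v(x))\rho^{(\lambda)}_{xy}=0\ \text{ for } x\in V_n\setminus(B_n\cup\{a\}),\qquad v=0\ \text{ on } B_n,\qquad v(a)=1$$ (the value does not depend on the choice of $v$), and $\mathcal P_n(\lambda)=\infty$ if there is no solution. Then the following holds. (a) The sequence $\{\mathcal P_n(\lambda)\}_{n\ge1}$ converges locally uniformly in the domain $\{\operatorname{Re}\lambda>0\}$. (b) If $L_{xy}>0$ for all $xy\in E$ and $$S_D:=\sup_{xy\in E}\frac{D_{xy}}{L_{xy}}<\infty,\qquad S_R:=\sup_{xy\in E}\frac{R_{xy}}{L_{xy}}<\infty,$$ then $\{\mathcal P_n(\lambda)\}$ converges locally uniformly in $\Omega=\{\lambda\in\mathbb C:\operatorname{Im}\lambda\ne0,\ |\lambda|^2>S_D\}$. (c) If, in addition to the hypotheses of (b), $S_D^*:=\inf_{xy\in E}\frac{D_{xy}}{L_{xy}}>0$, then $\{\mathcal P_n(\lambda)\}$ converges locally uniformly in $\Omega^*=\{\lambda\in\mathbb C:\operatorname{Im}\lambda\ne0,\ |\lambda|^2<S_D^*\}$.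 In all cases the domain in question is contained in $\Lambda$, all $\mathcal P_n$ $(n\ge1)$ are finite there, and the limit $\mathcal P(\lambda)=\lim_{n\to\infty}\mathcal P_n(\lambda)$ is a holomorphic function in that domain. -/

import Mathlib

noncomputable section

/-! ### Finite networks, given by complex weights `ρ x y` on a finite vertex set
(`ρ x y = 0` when `x`, `y` are not joined by an edge), a source `a` and a ground `B`. -/

namespace FiniteNetwork

variable {W : Type*} [Fintype W]

/-- The physical Laplacian `Δ_ρ f (x) = ∑_y (f y - f x) ρ_{xy}`. -/
def laplacian (ρ : W → W → ℂ) (f : W → ℂ) (x : W) : ℂ :=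
  ∑ y, (f y - f x) * ρ x y

/-- `v` solves the Dirichlet problem with unit voltage at `a` and zero voltage on `B`. -/
structure IsVoltage (ρ : W → W → ℂ) (a : W) (B : Set W) (v : W → ℂ) : Prop where
  harmonic : ∀ x, x ∉ B → x ≠ a → laplacian ρ v x = 0
  ground : ∀ x ∈ B, v x = 0
  source : v a = 1

/-- The total current through `a`. -/
def current (ρ : W → W → ℂ) (a : W) (v : W → ℂ) : ℂ :=
  ∑ x, (1 - v x) * ρ x a

open Classical in
/-- The effective admittance, with values in `ℂ ∪ {∞}`: the total current through `a` of a solution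
of the Dirichlet problem, and `∞` if there is no solution. For symmetric `ρ` the value
does not depend on the solution. -/
def effectiveAdmittance (ρ : W → W → ℂ) (a : W) (B : Set W) : OnePoint ℂ :=
  if h : ∃ v : W → ℂ, IsVoltage ρ a B v then ((current ρ a h.choose : ℂ) : OnePoint ℂ)
  else OnePoint.infty

end FiniteNetwork

/-- An infinite, locally finite, connected graph with resistances `R`, inductances `L` and inverse
capacitances `D` on the edges, a source vertex `a` and a (possibly empty) ground set `B`.
The values of `R`, `L`, `D` off the edge set are irrelevant. -/
structure InfiniteNetwork (V : Type*) where
  graph : SimpleGraph V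
  infinite : Infinite V
  connected : graph.Connected
  locallyFinite : ∀ x, (graph.neighborSet x).Finite
  R : Sym2 V → ℝ
  L : Sym2 V → ℝ
  D : Sym2 V → ℝ
  R_nonneg : ∀ e ∈ graph.edgeSet, 0 ≤ R e
  L_nonneg : ∀ e ∈ graph.edgeSet, 0 ≤ L e
  D_nonneg : ∀ e ∈ graph.edgeSet, 0 ≤ D e
  sum_pos : ∀ e ∈ graph.edgeSet, 0 < R e + L e + D e
  a : V
  B : Set V
  a_notMem_B : a ∉ B

namespace InfiniteNetwork

variable {V : Type*} (N : InfiniteNetwork V)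

/-- The impedance `R + L λ + D / λ` of an edge. -/
def impedance (lam : ℂ) (e : Sym2 V) : ℂ :=
  (N.R e : ℂ) + (N.L e : ℂ) * lam + (N.D e : ℂ) / lam

open Classical in
/-- The admittance `ρ_{xy} = 1 / z_{xy}` for `x ∼ y`, extended by `0` to all other pairs. -/
def admittance (lam : ℂ) (x y : V) : ℂ :=
  if N.graph.Adj x y then 1 / N.impedance lam s(x, y) else 0

/-- The parameters `λ` for which all edge admittances are finite and non-zero. -/
def admissible : Set ℂ :=
  {lam | lam ≠ 0 ∧ ∀ e ∈ N.graph.edgeSet, N.impedance lam e ≠ 0}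

/-- The ball `V_n` around the source. -/
def ball (n : ℕ) : Set V := {x | N.graph.dist N.a x ≤ n}

/-- The sphere `∂V_n` around the source. -/
def sphere (n : ℕ) : Set V := {x | N.graph.dist N.a x = n}

theorem a_mem_ball (n : ℕ) : N.a ∈ N.ball n := by
  simp [ball]

theorem ball_finite (n : ℕ) : (N.ball n).Finite := by
  induction n with
  | zero =>
    refine (Set.finite_singleton N.a).subset fun x hx => ?_
    have h0 : N.graph.dist N.a x = 0 := Nat.le_zero.mp hx
    exact ((N.connected.dist_eq_zero_iff).mp h0).symm
  | succ n ih =>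
    refine (ih.union (ih.biUnion fun x _ => N.locallyFinite x)).subset fun x hx => ?_
    obtain ⟨p, hp⟩ := N.connected.exists_walk_length_eq_dist x N.a
    rw [SimpleGraph.dist_comm] at hp
    cases p with
    | nil => exact Or.inl (N.a_mem_ball n)
    | cons h q =>
      refine Or.inr (Set.mem_biUnion ?_ h.symm)
      have hq := SimpleGraph.dist_le q.reverse
      have hx' : N.graph.dist N.a x ≤ n + 1 := hx
      simp only [SimpleGraph.Walk.length_cons, SimpleGraph.Walk.length_reverse] at hp hq
      change N.graph.dist N.a _ ≤ n
      omega

instance ballFintype (n : ℕ) : Fintype (N.ball n) := (N.ball_finite n).fintype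

/-- The ground `B_n = (B ∩ V_n) ∪ ∂V_n` of the `n`-th partial network, as a subset of `V_n`. -/
def partialGround (n : ℕ) : Set (N.ball n) := {x | (x : V) ∈ N.B ∪ N.sphere n}

/-- The partial effective admittance `P_n(λ)`: the effective admittance of the finite network
`(V_n, ρ|_{V_n}, a, B_n)`. It is meaningful for `n ≥ 1`, since `a ∈ ∂V_0`. -/
def partialAdmittance (n : ℕ) (lam : ℂ) : OnePoint ℂ :=
  FiniteNetwork.effectiveAdmittance (fun x y : N.ball n => N.admittance lam x y)
    ⟨N.a, N.a_mem_ball n⟩ (N.partialGround n)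

/-- On `U` all the `P_n`, `n ≥ 1`, are defined and finite, and they converge locally uniformly
to `P`, which is holomorphic on `U`. -/
def ConvergesHolomorphicallyOn (P : ℂ → ℂ) (U : Set ℂ) : Prop :=
  U ⊆ N.admissible ∧
  (∃ p : ℕ → ℂ → ℂ,
    (∀ n, 1 ≤ n → ∀ lam ∈ U, N.partialAdmittance n lam = ((p n lam : ℂ) : OnePoint ℂ)) ∧
    TendstoLocallyUniformlyOn p P Filter.atTop U) ∧
  DifferentiableOn ℂ P U

/-- The set of the ratios `D_{xy} / L_{xy}` over the edges. -/
def ratiosDL : Set ℝ := (fun e => N.D e / N.L e) '' N.graph.edgeSet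

/-- The set of the ratios `R_{xy} / L_{xy}` over the edges. -/
def ratiosRL : Set ℝ := (fun e => N.R e / N.L e) '' N.graph.edgeSet

end InfiniteNetwork

end

/-!
Weight the gradient of a function on the vertices so that it lies in the Hilbert space `ℓ²` of the
oriented edges. The Dirichlet problem on the `n`-th ball then asks for a vector `g ∈ f + Kₙ` with
`A g ⟂ Kₙ`, where `f` is the gradient of the indicator function of `a`, `Kₙ` consists of the
gradients of the functions supported in the interior of the ball, and `A` is the inverse of the
diagonal operator of the normalised impedances `z / (R + L + D)`. The admittance is `⟪f, A g⟫ / 2`.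

If one complex number `ω` satisfies `Re (ω z) ≥ R + L + D` on all edges, the impedance operator is
coercive, and hence so is `A`. By Céa's lemma the solutions then converge, as `Kₙ` increases, to
the solution for the closure of the union of the `Kₙ`. The value `⟪f, A g⟫` depends on `A` in a
Lipschitz manner, uniformly in `Kₙ`, so the convergence is locally uniform in `λ`; and the limit is
holomorphic in `λ` because inversion of operators is. In all three domains such an `ω` exists: a
positive real one if `Re λ > 0`, and in the other two domains one with a large imaginary part,
since there `L - D / |λ|²` has a constant sign and controls `L + D`.
-/

noncomputable section

section Galerkin

open Filter Topology
open scoped InnerProduct InnerProductSpace NNReal Ring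

variable {𝕜 H : Type*} [RCLike 𝕜] [NormedAddCommGroup H] [InnerProductSpace 𝕜 H]

/-- Coercivity of a bounded operator on a Hilbert space. As for `AntilipschitzWith`, the constant
stands on the large side, so that no positivity condition on it is needed. -/
def CoerciveWith (C : ℝ≥0) (A : H →L[𝕜] H) : Prop :=
  ∀ u, ‖u‖ ^ 2 ≤ C * ‖⟪u, A u⟫_𝕜‖

namespace CoerciveWith

variable {C : ℝ≥0} {A A' : H →L[𝕜] H}

theorem norm_le_of_norm_inner_le (hA : CoerciveWith C A) {u : H} {b : ℝ} (hb : 0 ≤ b)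
    (h : ‖⟪u, A u⟫_𝕜‖ ≤ b * ‖u‖) : ‖u‖ ≤ C * b := by
  rcases (norm_nonneg u).eq_or_lt with hu | hu
  · rw [← hu]
    positivity
  · refine le_of_mul_le_mul_right ?_ hu
    calc ‖u‖ * ‖u‖ = ‖u‖ ^ 2 := (sq _).symm
      _ ≤ C * ‖⟪u, A u⟫_𝕜‖ := hA u
      _ ≤ C * (b * ‖u‖) := by gcongr
      _ = C * b * ‖u‖ := by ring

theorem isUnit [CompleteSpace H] (hA : CoerciveWith C A) : IsUnit A := by
  refine A.isUnit_of_forall_le_norm_inner_map (c := (C + 1)⁻¹) (by positivity) fun u => ?_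
  rw [norm_inner_symm, NNReal.coe_inv, ← div_eq_mul_inv, div_le_iff₀ (by positivity)]
  calc ‖u‖ ^ 2 ≤ C * ‖⟪u, A u⟫_𝕜‖ := hA u
    _ ≤ ‖⟪u, A u⟫_𝕜‖ * (C + 1 : ℝ≥0) := by
      push_cast
      linarith [norm_nonneg ⟪u, A u⟫_𝕜]

theorem adjoint [CompleteSpace H] (hA : CoerciveWith C A) : CoerciveWith C (A†) := fun u => by
  rw [ContinuousLinearMap.adjoint_inner_right, norm_inner_symm]
  exact hA u

theorem inverse [CompleteSpace H] (hA : CoerciveWith C A) :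
    CoerciveWith (C * ‖A‖₊ ^ 2) A⁻¹ʳ := fun u => by
  have hu : A (A⁻¹ʳ u) = u := DFunLike.congr_fun (Ring.mul_inverse_cancel A hA.isUnit) u
  calc ‖u‖ ^ 2 = ‖A (A⁻¹ʳ u)‖ ^ 2 := by rw [hu]
    _ ≤ (‖A‖ * ‖A⁻¹ʳ u‖) ^ 2 := by gcongr; exact A.le_opNorm _
    _ = ‖A‖ ^ 2 * ‖A⁻¹ʳ u‖ ^ 2 := mul_pow _ _ _
    _ ≤ ‖A‖ ^ 2 * (C * ‖⟪A⁻¹ʳ u, A (A⁻¹ʳ u)⟫_𝕜‖) := by gcongr; exact hA _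
    _ = (C * ‖A‖₊ ^ 2 : ℝ≥0) * ‖⟪u, A⁻¹ʳ u⟫_𝕜‖ := by
      rw [hu, norm_inner_symm]
      push_cast
      ring

theorem of_norm_sub_le (hA : CoerciveWith C A) (h : 2 * C * ‖A' - A‖ ≤ 1) :
    CoerciveWith (2 * C) A' := fun u => by
  have hinner : ‖⟪u, A u⟫_𝕜‖ ≤ ‖⟪u, A' u⟫_𝕜‖ + ‖A' - A‖ * ‖u‖ ^ 2 := by
    calc ‖⟪u, A u⟫_𝕜‖ = ‖⟪u, A' u⟫_𝕜 - ⟪u, (A' - A) u⟫_𝕜‖ := by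
          rw [← inner_sub_right, sub_apply, sub_sub_cancel]
      _ ≤ ‖⟪u, A' u⟫_𝕜‖ + ‖⟪u, (A' - A) u⟫_𝕜‖ := norm_sub_le _ _
      _ ≤ ‖⟪u, A' u⟫_𝕜‖ + ‖u‖ * (‖A' - A‖ * ‖u‖) := by
        gcongr
        exact (norm_inner_le_norm _ _).trans (by gcongr; exact (A' - A).le_opNorm u)
      _ = _ := by ring
  have hu := (hA u).trans (mul_le_mul_of_nonneg_left hinner C.2)
  push_cast
  nlinarith [mul_le_mul_of_nonneg_right h (sq_nonneg ‖u‖)]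

theorem eventually {X : Type*} {l : Filter X} {T : X → H →L[𝕜] H} (hA : CoerciveWith C A)
    (hT : Tendsto T l (𝓝 A)) : ∀ᶠ z in l, CoerciveWith (2 * C) (T z) := by
  have hsub : Tendsto (fun z => 2 * C * ‖T z - A‖) l (𝓝 0) := by
    simpa only [mul_zero] using (tendsto_iff_norm_sub_tendsto_zero.mp hT).const_mul (2 * C : ℝ)
  filter_upwards [hsub.eventually_le_const zero_lt_one] with z hz
  exact hA.of_norm_sub_le hz

end CoerciveWith

/-- `g` solves the variational problem of `A` on the affine space `f + K`: this is the Dirichlet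
problem when `A` is a weight, `K` consists of gradients of functions vanishing at the boundary and
`f` is the gradient of an extension of the boundary values. -/
structure IsGalerkinSolution (K : Submodule 𝕜 H) (A : H →L[𝕜] H) (f g : H) : Prop where
  sub_mem : g - f ∈ K
  orthogonal : ∀ k ∈ K, ⟪k, A g⟫_𝕜 = 0

/-- The operator which the form `⟪u, A v⟫` induces on the subspace `K`. -/
def compression (K : Submodule 𝕜 H) [K.HasOrthogonalProjection] (A : H →L[𝕜] H) : K →L[𝕜] K :=
  K.orthogonalProjectionOnto ∘L A ∘L K.subtypeL

/-- The solution of the variational problem of a coercive operator `A` on `f + K`. -/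
def galerkinSolution (K : Submodule 𝕜 H) [K.HasOrthogonalProjection] (A : H →L[𝕜] H) (f : H) : H :=
  f - (compression K A)⁻¹ʳ (K.orthogonalProjectionOnto (A f))

/-- The value `⟪f, A g⟫` of the form at the solution `g` of the variational problem on `f + K`:
the abstract effective admittance. -/
def response (K : Submodule 𝕜 H) [K.HasOrthogonalProjection] (A : H →L[𝕜] H) (f : H) : 𝕜 :=
  ⟪f, A (galerkinSolution K A f)⟫_𝕜

variable {K : Submodule 𝕜 H} {C C' : ℝ≥0} {A A' : H →L[𝕜] H} {f g g' h : H}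

theorem IsGalerkinSolution.inner_eq (hg : IsGalerkinSolution K A f g) (hh : h - f ∈ K) :
    ⟪h, A g⟫_𝕜 = ⟪f, A g⟫_𝕜 := by
  rw [← sub_eq_zero, ← inner_sub_left, hg.orthogonal _ hh]

/-- Céa's lemma: `g` is a quasi-optimal approximation in `f + K` of every `g'` with `A g' ⟂ K`. -/
theorem IsGalerkinSolution.norm_sub_le (hA : CoerciveWith C A) (hg : IsGalerkinSolution K A f g)
    (hg' : ∀ k ∈ K, ⟪k, A g'⟫_𝕜 = 0) (hh : h - f ∈ K) : ‖g - g'‖ ≤ C * (‖A‖ * ‖h - g'‖) := by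
  refine hA.norm_le_of_norm_inner_le (by positivity) ?_
  have hgh : g - h ∈ K := sub_sub_sub_cancel_right g h f ▸ K.sub_mem hg.sub_mem hh
  have horth : ⟪g - h, A (g - g')⟫_𝕜 = 0 := by
    rw [map_sub, inner_sub_right, hg.orthogonal _ hgh, hg' _ hgh, sub_zero]
  calc ‖⟪g - g', A (g - g')⟫_𝕜‖ = ‖⟪g - h, A (g - g')⟫_𝕜 + ⟪h - g', A (g - g')⟫_𝕜‖ := by
        rw [← inner_add_left, sub_add_sub_cancel]
    _ = ‖⟪h - g', A (g - g')⟫_𝕜‖ := by rw [horth, zero_add]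
    _ ≤ ‖h - g'‖ * (‖A‖ * ‖g - g'‖) :=
      (norm_inner_le_norm _ _).trans (by gcongr; exact A.le_opNorm _)
    _ = ‖A‖ * ‖h - g'‖ * ‖g - g'‖ := by ring

theorem IsGalerkinSolution.norm_le (hA : CoerciveWith C A) (hg : IsGalerkinSolution K A f g) :
    ‖g‖ ≤ C * (‖A‖ * ‖f‖) := by
  simpa using hg.norm_sub_le hA (g' := 0) (h := f) (by simp) (by simp)

theorem IsGalerkinSolution.unique (hA : CoerciveWith C A) (hg : IsGalerkinSolution K A f g)
    (hg' : IsGalerkinSolution K A f g') : g = g' := by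
  have := hg.norm_sub_le hA hg'.orthogonal hg'.sub_mem
  rwa [sub_self, norm_zero, mul_zero, mul_zero, norm_le_zero_iff, sub_eq_zero] at this

theorem inner_compression [K.HasOrthogonalProjection] (u v : K) :
    ⟪u, compression K A v⟫_𝕜 = ⟪(u : H), A v⟫_𝕜 := by
  simp [compression]

theorem CoerciveWith.compression [K.HasOrthogonalProjection] (hA : CoerciveWith C A) :
    CoerciveWith C (compression K A) := fun u => by
  rw [inner_compression]
  exact hA u

theorem isGalerkinSolution_galerkinSolution [CompleteSpace K] (hA : CoerciveWith C A) (f : H) :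
    IsGalerkinSolution K A f (galerkinSolution K A f) where
  sub_mem := by simp [galerkinSolution]
  orthogonal k hk := by
    set w := (compression K A)⁻¹ʳ (K.orthogonalProjectionOnto (A f)) with hw
    have hcompr : compression K A w = K.orthogonalProjectionOnto (A f) :=
      DFunLike.congr_fun (Ring.mul_inverse_cancel _ hA.compression.isUnit) _
    have hinner : ⟪k, A f⟫_𝕜 = ⟪k, A w⟫_𝕜 := by
      rw [← inner_compression ⟨k, hk⟩ w, hcompr,
        Submodule.inner_orthogonalProjectionOnto_eq_of_mem_left]
    rw [galerkinSolution, ← hw, map_sub, inner_sub_right, hinner, sub_self]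

theorem IsGalerkinSolution.inner_eq_response [CompleteSpace K] (hA : CoerciveWith C A)
    (hg : IsGalerkinSolution K A f g) : ⟪f, A g⟫_𝕜 = response K A f := by
  rw [response, hg.unique hA (isGalerkinSolution_galerkinSolution hA f)]

/-- This evaluates both responses at the test vector that solves the adjoint problem of `A'`. -/
theorem response_sub_response [CompleteSpace H] [CompleteSpace K]
    (hA : CoerciveWith C A) (hA' : CoerciveWith C' A') (f : H) :
    response K A' f - response K A f =
      ⟪galerkinSolution K (A'†) f, (A' - A) (galerkinSolution K A f)⟫_𝕜 := by
  have hg := isGalerkinSolution_galerkinSolution (K := K) hA f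
  have hg' := isGalerkinSolution_galerkinSolution (K := K) hA' f
  have hd := isGalerkinSolution_galerkinSolution (K := K) hA'.adjoint f
  set d := galerkinSolution K (A'†) f
  have hadj : ⟪d, A' (galerkinSolution K A' f)⟫_𝕜 = ⟪d, A' (galerkinSolution K A f)⟫_𝕜 := by
    rw [← ContinuousLinearMap.adjoint_inner_left, ← ContinuousLinearMap.adjoint_inner_left,
      ← inner_conj_symm, hd.inner_eq hg'.sub_mem, ← hd.inner_eq hg.sub_mem, inner_conj_symm]
  rw [response, response, ← hg'.inner_eq hd.sub_mem, ← hg.inner_eq hd.sub_mem, hadj,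
    ← inner_sub_right, sub_apply]

theorem norm_response_sub_response_le [CompleteSpace H] [CompleteSpace K]
    (hA : CoerciveWith C A) (hA' : CoerciveWith C' A') (f : H) :
    ‖response K A' f - response K A f‖ ≤
      C' * (‖A'‖ * ‖f‖) * (‖A' - A‖ * (C * (‖A‖ * ‖f‖))) := by
  have hd := (isGalerkinSolution_galerkinSolution (K := K) hA'.adjoint f).norm_le hA'.adjoint
  have hg := (isGalerkinSolution_galerkinSolution (K := K) hA f).norm_le hA
  rw [LinearIsometryEquiv.norm_map] at hd
  rw [response_sub_response hA hA']
  refine (norm_inner_le_norm _ _).trans (mul_le_mul hd ?_ (norm_nonneg _) (by positivity))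
  exact ((A' - A).le_opNorm _).trans (by gcongr)

theorem differentiableAt_response [CompleteSpace K] {E : Type*} [NormedAddCommGroup E]
    [NormedSpace 𝕜 E] {T : E → H →L[𝕜] H} {z : E} (hT : DifferentiableAt 𝕜 T z)
    (hC : CoerciveWith C (T z)) (f : H) :
    DifferentiableAt 𝕜 (fun w => response K (T w) f) z := by
  have hcompr : DifferentiableAt 𝕜 (fun w => compression K (T w)) z :=
    (differentiableAt_const _).clm_comp (hT.clm_comp (differentiableAt_const _))
  have hinv : DifferentiableAt 𝕜 (fun w => (compression K (T w))⁻¹ʳ) z :=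
    hcompr.inverse hC.compression.isUnit
  have hproj : DifferentiableAt 𝕜 (fun w => K.orthogonalProjectionOnto (T w f)) z :=
    (differentiableAt_const K.orthogonalProjectionOnto).clm_apply
      (hT.clm_apply (differentiableAt_const f))
  have hsol : DifferentiableAt 𝕜 (fun w => galerkinSolution K (T w) f) z :=
    (differentiableAt_const f).sub
      ((differentiableAt_const K.subtypeL).clm_apply (hinv.clm_apply hproj))
  exact (differentiableAt_const (innerSL 𝕜 f)).clm_apply (hT.clm_apply hsol)

section Exhaustion

variable [CompleteSpace H] {ι : Type*} [Preorder ι] {Kn : ι → Submodule 𝕜 H}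
  [∀ n, CompleteSpace (Kn n)]

theorem tendsto_galerkinSolution (hmono : Monotone Kn) (hA : CoerciveWith C A) (f : H) :
    Tendsto (fun n => galerkinSolution (Kn n) A f) atTop
      (𝓝 (galerkinSolution (⨆ n, Kn n).topologicalClosure A f)) := by
  set K := (⨆ n, Kn n).topologicalClosure
  have hg := isGalerkinSolution_galerkinSolution (K := K) hA f
  set g := galerkinSolution K A f
  set h : ι → H := fun n => f + (Kn n).starProjection (g - f)
  have hle (n : ι) : Kn n ≤ K := (le_iSup Kn n).trans (Submodule.le_topologicalClosure _)
  have hcea (n : ι) : ‖galerkinSolution (Kn n) A f - g‖ ≤ C * (‖A‖ * ‖h n - g‖) :=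
    (isGalerkinSolution_galerkinSolution hA f).norm_sub_le hA
      (fun k hk => hg.orthogonal k (hle n hk))
      (by simpa only [h, add_sub_cancel_left] using Submodule.starProjection_apply_mem _ _)
  have hh : Tendsto h atTop (𝓝 g) := by
    have := Submodule.starProjection_tendsto_closure_iSup Kn hmono (g - f)
    rw [Submodule.starProjection_eq_self_iff.mpr hg.sub_mem] at this
    simpa only [add_sub_cancel] using this.const_add f
  rw [tendsto_iff_norm_sub_tendsto_zero] at hh ⊢
  refine squeeze_zero (fun _ => norm_nonneg _) hcea ?_
  simpa only [mul_zero] using (hh.const_mul ‖A‖).const_mul (C : ℝ)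

theorem tendsto_response (hmono : Monotone Kn) (hA : CoerciveWith C A) (f : H) :
    Tendsto (fun n => response (Kn n) A f) atTop
      (𝓝 (response (⨆ n, Kn n).topologicalClosure A f)) :=
  tendsto_const_nhds.inner ((A.continuous.tendsto _).comp (tendsto_galerkinSolution hmono hA f))

theorem tendstoLocallyUniformlyOn_response (hmono : Monotone Kn) {X : Type*} [TopologicalSpace X]
    {T : X → H →L[𝕜] H} {U : Set X} (hT : ContinuousOn T U)
    (hC : ∀ z ∈ U, ∃ C, CoerciveWith C (T z)) (f : H) :
    TendstoLocallyUniformlyOn (fun n z => response (Kn n) (T z) f)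
      (fun z => response (⨆ n, Kn n).topologicalClosure (T z) f) atTop U := by
  set K := (⨆ n, Kn n).topologicalClosure
  rw [tendstoLocallyUniformlyOn_iff_forall_tendsto]
  intro z hz
  obtain ⟨C, hCz⟩ := hC z hz
  have hTz : Tendsto T (𝓝[U] z) (𝓝 (T z)) := hT z hz
  have hsub : Tendsto (fun w => ‖T w - T z‖) (𝓝[U] z) (𝓝 0) :=
    tendsto_iff_norm_sub_tendsto_zero.mp hTz
  set b : X → ℝ := fun w =>
    (2 * C : ℝ≥0) * (‖T w‖ * ‖f‖) * (‖T w - T z‖ * (C * (‖T z‖ * ‖f‖)))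
  have hb : Tendsto b (𝓝[U] z) (𝓝 0) := by
    simpa only [zero_mul, mul_zero] using
      ((hTz.norm.mul_const ‖f‖).const_mul ((2 * C : ℝ≥0) : ℝ)).mul
        (hsub.mul_const (C * (‖T z‖ * ‖f‖)))
  have hpt : Tendsto (fun n => dist (response K (T z) f) (response (Kn n) (T z) f)) atTop
      (𝓝 0) := by
    have : Tendsto (fun n => response (Kn n) (T z) f) atTop (𝓝 (response K (T z) f)) :=
      tendsto_response hmono hCz f
    simpa only [dist_self] using (tendsto_const_nhds (x := response K (T z) f)).dist this
  refine tendsto_uniformity_iff_dist_tendsto_zero.mpr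
    (squeeze_zero' (.of_forall fun _ => dist_nonneg)
      (g := fun y => b y.2 + dist (response K (T z) f) (response (Kn y.1) (T z) f) + b y.2) ?_ ?_)
  · filter_upwards [tendsto_snd.eventually (hCz.eventually hTz)] with ⟨n, w⟩ hw
    refine (dist_triangle4 _ (response K (T z) f) (response (Kn n) (T z) f) _).trans ?_
    gcongr
    · exact (dist_eq_norm _ _).trans_le (norm_response_sub_response_le hCz hw f)
    · rw [dist_comm]
      exact (dist_eq_norm _ _).trans_le (norm_response_sub_response_le hCz hw f)
  · simpa only [add_zero, Function.comp_def] using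
      ((hb.comp tendsto_snd).add (hpt.comp tendsto_fst)).add (hb.comp tendsto_snd)

end Exhaustion

end Galerkin

section Diagonal

open scoped ENNReal InnerProductSpace NNReal

variable {ι : Type*}

/-- The multiplication operator on `ℓᵖ(ι)` of a bounded function `m`. -/
def diagonal {𝕜 : Type*} [NontriviallyNormedField 𝕜] {p : ℝ≥0∞} [Fact (1 ≤ p)] (m : ι → 𝕜)
    {C : ℝ≥0} (hm : ∀ i, ‖m i‖ ≤ C) : lp (fun _ : ι => 𝕜) p →L[𝕜] lp (fun _ : ι => 𝕜) p :=
  lp.mapCLM p (fun i => m i • ContinuousLinearMap.id 𝕜 𝕜) C.2 fun i => by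
    rw [norm_smul, ContinuousLinearMap.norm_id, mul_one]
    exact hm i

theorem coerciveWith_of_one_le_re_mul {𝕜 : Type*} [RCLike 𝕜] {m : ι → 𝕜} {ω : 𝕜}
    {T : lp (fun _ : ι => 𝕜) 2 →L[𝕜] lp (fun _ : ι => 𝕜) 2} (hT : ∀ u i, T u i = m i * u i)
    (hm : ∀ i, 1 ≤ RCLike.re (ω * m i)) : CoerciveWith ‖ω‖₊ T := fun u => by
  have hre := RCLike.hasSum_re 𝕜 ((lp.hasSum_inner (𝕜 := 𝕜) u (T u)).mul_left ω)
  have hnorm : HasSum (fun i => ‖u i‖ ^ 2) (‖u‖ ^ 2) := by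
    simpa using lp.hasSum_norm (by norm_num) u
  have hle : ‖u‖ ^ 2 ≤ RCLike.re (ω * ⟪u, T u⟫_𝕜) := by
    refine hasSum_le (fun i => ?_) hnorm hre
    have : ω * ⟪u i, T u i⟫_𝕜 = ((‖u i‖ ^ 2 : ℝ) : 𝕜) * (ω * m i) := by
      rw [hT, ← smul_eq_mul (m i), inner_smul_right, inner_self_eq_norm_sq_to_K]
      push_cast
      ring
    rw [this, RCLike.re_ofReal_mul]
    exact le_mul_of_one_le_right (sq_nonneg _) (hm i)
  calc ‖u‖ ^ 2 ≤ ‖ω * ⟪u, T u⟫_𝕜‖ := hle.trans (RCLike.re_le_norm _)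
    _ = ‖ω‖₊ * ‖⟪u, T u⟫_𝕜‖ := norm_mul _ _

end Diagonal

section Impedance

theorem exists_add_le_re_mul {lam : ℂ} {S : ℝ} (him : lam.im ≠ 0) (hS : S < ‖lam‖ ^ 2) :
    ∃ ω : ℂ, ∀ r l d : ℝ, 0 ≤ l → 0 ≤ d → d ≤ S * l →
      r + l + d ≤ (ω * (r + l * lam + d / lam)).re := by
  have hlam : lam ≠ 0 := by
    rintro rfl
    exact him Complex.zero_im
  set q := ‖lam‖ ^ 2 with hq
  have hq0 : 0 < q := by positivity
  set x := lam.re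
  set y := lam.im
  set t := (1 + q + 2 * |x|) / (y ^ 2 * (1 - S / q))
  have hgap : 0 < 1 - S / q := sub_pos.mpr ((div_lt_one hq0).mpr hS)
  have ht : t * y ^ 2 * (1 - S / q) = 1 + q + 2 * |x| := by
    rw [mul_assoc, div_mul_cancel₀ _ (by positivity)]
  -- A large multiple of the imaginary part of the impedance absorbs the negative part of its
  -- real part.
  refine ⟨1 - t * y * Complex.I, fun r l d hl hd hdl => ?_⟩
  have hdS : d / q ≤ S / q * l := by
    rw [div_mul_eq_mul_div]
    gcongr
  have hdlq : d / q ≤ l := hdS.trans (mul_le_of_le_one_left hl (sub_pos.mp hgap).le)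
  have hd_le : d ≤ q * l := (div_le_iff₀' hq0).mp hdlq
  have hre : ((1 - t * y * Complex.I) * (r + l * lam + d / lam)).re =
      r + x * (l + d / q) + t * y ^ 2 * (l - d / q) := by
    simp only [Complex.mul_re, Complex.mul_im, Complex.sub_re, Complex.sub_im, Complex.add_re,
      Complex.add_im, Complex.div_re, Complex.div_im, Complex.one_re, Complex.one_im,
      Complex.ofReal_re, Complex.ofReal_im, Complex.I_re, Complex.I_im,
      Complex.normSq_eq_norm_sq, ← hq]
    ring
  have hx : -(2 * |x| * l) ≤ x * (l + d / q) := by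
    refine (neg_le_neg ?_).trans (neg_abs_le _)
    rw [abs_mul, abs_of_nonneg (by positivity : 0 ≤ l + d / q)]
    nlinarith [mul_le_mul_of_nonneg_left hdlq (abs_nonneg x)]
  have hy : (1 + q + 2 * |x|) * l ≤ t * y ^ 2 * (l - d / q) := by
    rw [← ht, mul_assoc]
    gcongr
    linarith
  rw [hre]
  linarith

end Impedance

namespace InfiniteNetwork

open Filter Topology
open scoped InnerProductSpace NNReal Ring

variable {V : Type*} (N : InfiniteNetwork V)

section Operators

/-- The Hilbert space `ℓ²` of the oriented edges, in which weighted gradients live. -/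
abbrev EdgeSpace : Type _ := lp (fun _ : N.graph.Dart => ℂ) 2

/-- The sum `R + L + D` on an edge, by which impedances are normalised: this makes the operators
of `R`, `L` and `D` on `EdgeSpace` bounded, although `R`, `L` and `D` need not be. -/
def total (e : Sym2 V) : ℝ := N.R e + N.L e + N.D e

theorem total_pos {e : Sym2 V} (he : e ∈ N.graph.edgeSet) : 0 < N.total e :=
  N.sum_pos e he

theorem norm_div_total_le_one {e : Sym2 V} (he : e ∈ N.graph.edgeSet) {r : ℝ} (hr : 0 ≤ r)
    (h : r ≤ N.R e + N.L e + N.D e) : ‖(r / N.total e : ℂ)‖ ≤ (1 : ℝ≥0) := by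
  rw [← Complex.ofReal_div, Complex.norm_of_nonneg (div_nonneg hr (N.total_pos he).le)]
  exact div_le_one_of_le₀ h (N.total_pos he).le

theorem norm_R_div_total_le_one (d : N.graph.Dart) :
    ‖(N.R d.edge / N.total d.edge : ℂ)‖ ≤ (1 : ℝ≥0) :=
  N.norm_div_total_le_one d.edge_mem (N.R_nonneg _ d.edge_mem) <| by
    linarith [N.L_nonneg _ d.edge_mem, N.D_nonneg _ d.edge_mem]

theorem norm_L_div_total_le_one (d : N.graph.Dart) :
    ‖(N.L d.edge / N.total d.edge : ℂ)‖ ≤ (1 : ℝ≥0) :=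
  N.norm_div_total_le_one d.edge_mem (N.L_nonneg _ d.edge_mem) <| by
    linarith [N.R_nonneg _ d.edge_mem, N.D_nonneg _ d.edge_mem]

theorem norm_D_div_total_le_one (d : N.graph.Dart) :
    ‖(N.D d.edge / N.total d.edge : ℂ)‖ ≤ (1 : ℝ≥0) :=
  N.norm_div_total_le_one d.edge_mem (N.D_nonneg _ d.edge_mem) <| by
    linarith [N.R_nonneg _ d.edge_mem, N.L_nonneg _ d.edge_mem]

/-- Multiplication by the normalised impedances. -/
def impedanceOp (lam : ℂ) : N.EdgeSpace →L[ℂ] N.EdgeSpace :=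
  diagonal _ N.norm_R_div_total_le_one + lam • diagonal _ N.norm_L_div_total_le_one +
    lam⁻¹ • diagonal _ N.norm_D_div_total_le_one

/-- Multiplication by the normalised admittances. -/
def admittanceOp (lam : ℂ) : N.EdgeSpace →L[ℂ] N.EdgeSpace := (N.impedanceOp lam)⁻¹ʳ

/-- The parameters `λ ≠ 0` for which multiplication by a single number moves all edge impedances
into the right half plane, uniformly with respect to `R + L + D`. -/
def coerciveSet : Set ℂ :=
  {lam | lam ≠ 0 ∧ ∃ ω : ℂ, ∀ e ∈ N.graph.edgeSet, N.total e ≤ (ω * N.impedance lam e).re}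

theorem impedanceOp_apply (lam : ℂ) (u : N.EdgeSpace) (d : N.graph.Dart) :
    N.impedanceOp lam u d = N.impedance lam d.edge / N.total d.edge * u d := by
  change N.R d.edge / N.total d.edge * u d + lam * (N.L d.edge / N.total d.edge * u d) +
    lam⁻¹ * (N.D d.edge / N.total d.edge * u d) = _
  rw [impedance]
  ring

theorem differentiableAt_impedanceOp {lam : ℂ} (h : lam ≠ 0) :
    DifferentiableAt ℂ N.impedanceOp lam :=
  ((differentiableAt_const _).add (differentiableAt_id.smul_const _)).add
    ((differentiableAt_inv h).smul_const _)

variable {N} {lam : ℂ}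

theorem coerciveSet_subset_admissible : N.coerciveSet ⊆ N.admissible := by
  rintro lam ⟨h0, ω, hω⟩
  refine ⟨h0, fun e he hz => (N.total_pos he).not_ge ?_⟩
  simpa only [hz, mul_zero, Complex.zero_re] using hω e he

theorem exists_coerciveWith_impedanceOp (h : lam ∈ N.coerciveSet) :
    ∃ C, CoerciveWith C (N.impedanceOp lam) := by
  obtain ⟨-, ω, hω⟩ := h
  refine ⟨_, coerciveWith_of_one_le_re_mul (N.impedanceOp_apply lam) (ω := ω) fun d => ?_⟩
  rw [← mul_div_assoc, RCLike.re_eq_complex_re, Complex.div_ofReal_re]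
  exact (one_le_div (N.total_pos d.edge_mem)).mpr (hω _ d.edge_mem)

theorem isUnit_impedanceOp (h : lam ∈ N.coerciveSet) : IsUnit (N.impedanceOp lam) := by
  obtain ⟨C, hC⟩ := exists_coerciveWith_impedanceOp h
  exact hC.isUnit

theorem exists_coerciveWith_admittanceOp (h : lam ∈ N.coerciveSet) :
    ∃ C, CoerciveWith C (N.admittanceOp lam) := by
  obtain ⟨C, hC⟩ := exists_coerciveWith_impedanceOp h
  exact ⟨_, hC.inverse⟩

theorem differentiableAt_admittanceOp (h : lam ∈ N.coerciveSet) :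
    DifferentiableAt ℂ N.admittanceOp lam :=
  (N.differentiableAt_impedanceOp h.1).inverse (isUnit_impedanceOp h)

theorem admittanceOp_apply (h : lam ∈ N.coerciveSet) (u : N.EdgeSpace) (d : N.graph.Dart) :
    N.admittanceOp lam u d = N.total d.edge / N.impedance lam d.edge * u d := by
  have hz : N.impedance lam d.edge ≠ 0 := (coerciveSet_subset_admissible h).2 _ d.edge_mem
  have htotal : (N.total d.edge : ℂ) ≠ 0 := Complex.ofReal_ne_zero.mpr (N.total_pos d.edge_mem).ne'
  have hinv : N.impedanceOp lam (N.admittanceOp lam u) = u :=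
    DFunLike.congr_fun (Ring.mul_inverse_cancel _ (isUnit_impedanceOp h)) u
  rw [← congrArg (fun v : N.EdgeSpace => v d) hinv]
  beta_reduce
  rw [impedanceOp_apply]
  field_simp

end Operators

section Domains

variable {N} {lam : ℂ} {S : ℝ}

theorem mem_coerciveSet_of_re_pos (h : 0 < lam.re) : lam ∈ N.coerciveSet := by
  have h0 : lam ≠ 0 := by
    rintro rfl
    exact h.ne' Complex.zero_re
  have hinv : 0 < (lam⁻¹).re := by
    rw [Complex.inv_re]
    exact div_pos h (Complex.normSq_pos.mpr h0)
  set c := min 1 (min lam.re (lam⁻¹).re)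
  have hc : 0 < c := by positivity
  refine ⟨h0, (c⁻¹ : ℝ), fun e he => ?_⟩
  have hre : (N.impedance lam e).re = N.R e + N.L e * lam.re + N.D e * (lam⁻¹).re := by
    simp only [impedance, div_eq_mul_inv, Complex.add_re, Complex.ofReal_re, Complex.re_ofReal_mul]
  rw [Complex.re_ofReal_mul, hre, ← div_eq_inv_mul, le_div_iff₀ hc, total, add_mul, add_mul]
  gcongr
  · exact mul_le_of_le_one_right (N.R_nonneg e he) (min_le_left _ _)
  · exact N.L_nonneg e he
  · exact (min_le_right _ _).trans (min_le_left _ _)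
  · exact N.D_nonneg e he
  · exact (min_le_right _ _).trans (min_le_right _ _)

theorem mem_coerciveSet_of_lt_norm_sq (hS : ∀ e ∈ N.graph.edgeSet, N.D e ≤ S * N.L e)
    (him : lam.im ≠ 0) (h : S < ‖lam‖ ^ 2) : lam ∈ N.coerciveSet := by
  obtain ⟨ω, hω⟩ := exists_add_le_re_mul him h
  refine ⟨?_, ω, fun e he => hω _ _ _ (N.L_nonneg e he) (N.D_nonneg e he) (hS e he)⟩
  rintro rfl
  exact him Complex.zero_im

theorem mem_coerciveSet_of_norm_sq_lt (hS : ∀ e ∈ N.graph.edgeSet, S * N.L e ≤ N.D e)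
    (him : lam.im ≠ 0) (h : ‖lam‖ ^ 2 < S) : lam ∈ N.coerciveSet := by
  have h0 : lam ≠ 0 := by
    rintro rfl
    exact him Complex.zero_im
  have hpos : 0 < ‖lam‖ ^ 2 := by positivity
  have him_inv : (lam⁻¹).im ≠ 0 := by
    rw [Complex.inv_im]
    exact div_ne_zero (neg_ne_zero.mpr him) (Complex.normSq_pos.mpr h0).ne'
  have hlt : S⁻¹ < ‖lam⁻¹‖ ^ 2 := by
    rw [norm_inv, inv_pow]
    exact inv_strictAnti₀ hpos h
  -- The substitution `λ ↦ λ⁻¹` exchanges the roles of `L` and `D`.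
  obtain ⟨ω, hω⟩ := exists_add_le_re_mul him_inv hlt
  refine ⟨h0, ω, fun e he => ?_⟩
  have hLD : N.L e ≤ S⁻¹ * N.D e := (le_inv_mul_iff₀ (hpos.trans h)).mpr (hS e he)
  have := hω (N.R e) _ _ (N.D_nonneg e he) (N.L_nonneg e he) hLD
  rwa [add_right_comm, add_right_comm (N.R e : ℂ), div_inv_eq_mul, ← div_eq_mul_inv] at this

theorem D_le_sSup_ratiosDL_mul_L (hL : ∀ e ∈ N.graph.edgeSet, 0 < N.L e)
    (hD : BddAbove N.ratiosDL) : ∀ e ∈ N.graph.edgeSet, N.D e ≤ sSup N.ratiosDL * N.L e :=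
  fun e he => (div_le_iff₀ (hL e he)).mp (le_csSup hD ⟨e, he, rfl⟩)

theorem sInf_ratiosDL_mul_L_le_D (hL : ∀ e ∈ N.graph.edgeSet, 0 < N.L e) :
    ∀ e ∈ N.graph.edgeSet, sInf N.ratiosDL * N.L e ≤ N.D e := by
  have hbdd : BddBelow N.ratiosDL := by
    refine ⟨0, ?_⟩
    rintro _ ⟨e, he, rfl⟩
    exact div_nonneg (N.D_nonneg e he) (N.L_nonneg e he)
  exact fun e he => (le_div_iff₀ (hL e he)).mp (csInf_le hbdd ⟨e, he, rfl⟩)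

end Domains

section Gradient

theorem finite_setOf_fst_eq (x : V) : {d : N.graph.Dart | d.fst = x}.Finite := by
  have := (N.locallyFinite x).to_subtype
  refine (Set.finite_range (N.graph.dartOfNeighborSet x)).subset ?_
  rintro d rfl
  exact ⟨⟨d.snd, d.adj⟩, rfl⟩

/-- The finite set of the oriented edges that start at `x`. -/
def dartsAt (x : V) : Finset N.graph.Dart := (N.finite_setOf_fst_eq x).toFinset

/-- The factor by which the gradient is weighted. With it, the Laplacian `Δ_ρ` is represented
by `admittanceOp`, in which admittances are multiplied by `R + L + D`. -/
def weight (e : Sym2 V) : ℝ := (√(N.total e))⁻¹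

open Classical in
/-- The weighted gradient of the indicator function of `x`. -/
def gradSingle (x : V) : N.EdgeSpace :=
  ∑ d ∈ N.dartsAt x,
    (lp.single 2 d.symm (N.weight d.edge : ℂ) - lp.single 2 d (N.weight d.edge : ℂ))

/-- The weighted gradient of a finitely supported function. -/
def grad : (V →₀ ℂ) →ₗ[ℂ] N.EdgeSpace := Finsupp.linearCombination ℂ N.gradSingle

theorem weight_sq {e : Sym2 V} (he : e ∈ N.graph.edgeSet) : N.weight e ^ 2 = (N.total e)⁻¹ := by
  rw [weight, inv_pow, Real.sq_sqrt (N.total_pos he).le]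

variable {N}

theorem mem_dartsAt {x : V} {d : N.graph.Dart} : d ∈ N.dartsAt x ↔ d.fst = x := by
  rw [dartsAt, Set.Finite.mem_toFinset, Set.mem_ofPred_eq]

theorem inner_gradSingle (x : V) (u : N.EdgeSpace) :
    ⟪N.gradSingle x, u⟫_ℂ = ∑ d ∈ N.dartsAt x, (N.weight d.edge : ℂ) * (u d.symm - u d) := by
  classical
  rw [gradSingle, sum_inner]
  refine Finset.sum_congr rfl fun d _ => ?_
  rw [inner_sub_left, lp.inner_single_left, lp.inner_single_left, RCLike.inner_apply',
    RCLike.inner_apply', Complex.conj_ofReal, mul_sub]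

open Classical in
theorem gradSingle_apply (x : V) (d : N.graph.Dart) :
    N.gradSingle x d =
      N.weight d.edge * ((if d.snd = x then 1 else 0) - (if d.fst = x then 1 else 0)) := by
  have hsymm (d' : N.graph.Dart) : d = d'.symm ↔ d.symm = d' :=
    SimpleGraph.Dart.symm_involutive.eq_iff.symm
  simp only [gradSingle, lp.coeFn_sum, Finset.sum_apply, lp.coeFn_sub, Pi.sub_apply,
    lp.single_apply, Pi.single_apply, hsymm, Finset.sum_sub_distrib, Finset.sum_ite_eq,
    mem_dartsAt, SimpleGraph.Dart.edge_symm, mul_sub, mul_ite, mul_one, mul_zero]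
  rfl

theorem grad_single (x : V) : N.grad (Finsupp.single x 1) = N.gradSingle x := by
  rw [grad, Finsupp.linearCombination_single, one_smul]

theorem grad_apply (φ : V →₀ ℂ) (d : N.graph.Dart) :
    N.grad φ d = N.weight d.edge * (φ d.snd - φ d.fst) := by
  classical
  induction φ using Finsupp.induction_linear with
  | zero => simp
  | add f g hf hg =>
    rw [map_add, lp.coeFn_add, Pi.add_apply, hf, hg, Finsupp.add_apply, Finsupp.add_apply]
    ring
  | single x c =>
    rw [grad, Finsupp.linearCombination_single, lp.coeFn_smul, Pi.smul_apply, gradSingle_apply,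
      Finsupp.single_apply, Finsupp.single_apply, smul_eq_mul]
    simp only [eq_comm (a := x)]
    split_ifs <;> ring

theorem mem_ball_of_adj {n : ℕ} {x y : V} (hx : N.graph.dist N.a x < n) (h : N.graph.Adj x y) :
    y ∈ N.ball n :=
  calc N.graph.dist N.a y ≤ N.graph.dist N.a x + N.graph.dist x y := N.connected.dist_triangle
    _ = N.graph.dist N.a x + 1 := by rw [SimpleGraph.dist_eq_one_iff_adj.mpr h]
    _ ≤ n := hx

theorem sum_ball_mul_admittance (lam : ℂ) {n : ℕ} {x : V} (hx : N.graph.dist N.a x < n)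
    (F : V → ℂ) : ∑ y : N.ball n, F y * N.admittance lam x y =
      ∑ d ∈ N.dartsAt x, F d.snd / N.impedance lam d.edge := by
  rw [← Finset.sum_subtype (N.ball_finite n).toFinset (fun y => Set.Finite.mem_toFinset _)
    (fun y => F y * N.admittance lam x y)]
  refine (Finset.sum_of_injOn (fun d => d.snd) ?_ ?_ ?_ ?_).symm
  · intro d hd d' hd' h
    exact SimpleGraph.Dart.ext _ _
      (Prod.ext ((mem_dartsAt.mp hd).trans (mem_dartsAt.mp hd').symm) h)
  · intro d hd
    obtain rfl := mem_dartsAt.mp hd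
    exact (Set.Finite.mem_toFinset _).mpr (mem_ball_of_adj hx d.adj)
  · intro y _ hy
    rw [admittance, if_neg, mul_zero]
    exact fun hadj => hy ⟨⟨(x, y), hadj⟩, mem_dartsAt.mpr rfl, rfl⟩
  · intro d hd
    obtain rfl := mem_dartsAt.mp hd
    rw [admittance, if_pos d.adj, mul_one_div]
    rfl

theorem inner_gradSingle_admittanceOp_grad {lam : ℂ} (h : lam ∈ N.coerciveSet) {n : ℕ} {x : V}
    (hx : N.graph.dist N.a x < n) (φ : V →₀ ℂ) :
    ⟪N.gradSingle x, N.admittanceOp lam (N.grad φ)⟫_ℂ =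
      2 * ∑ y : N.ball n, (φ x - φ y) * N.admittance lam x y := by
  rw [sum_ball_mul_admittance lam hx fun y => φ x - φ y, inner_gradSingle, Finset.mul_sum]
  refine Finset.sum_congr rfl fun d hd => ?_
  obtain rfl := mem_dartsAt.mp hd
  have hweight : (N.weight d.edge : ℂ) ^ 2 * N.total d.edge = 1 := by
    rw [← Complex.ofReal_pow, N.weight_sq d.edge_mem, ← Complex.ofReal_mul,
      inv_mul_cancel₀ (N.total_pos d.edge_mem).ne', Complex.ofReal_one]
  rw [admittanceOp_apply h, admittanceOp_apply h, grad_apply, grad_apply,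
    SimpleGraph.Dart.edge_symm]
  change (N.weight d.edge : ℂ) *
    (N.total d.edge / N.impedance lam d.edge * (N.weight d.edge * (φ d.fst - φ d.snd)) -
      N.total d.edge / N.impedance lam d.edge * (N.weight d.edge * (φ d.snd - φ d.fst))) = _
  linear_combination 2 * ((φ d.fst - φ d.snd) / N.impedance lam d.edge) * hweight

end Gradient

section Voltage

/-- The vertices of the `n`-th partial network at which the voltage is not prescribed. -/
def interior (n : ℕ) : Set V := {x | N.graph.dist N.a x < n ∧ x ≠ N.a ∧ x ∉ N.B}

/-- The gradients of the functions supported in the interior of the `n`-th partial network. -/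
def testSpace (n : ℕ) : Submodule ℂ N.EdgeSpace :=
  Submodule.span ℂ (N.gradSingle '' N.interior n)

theorem interior_subset_ball (n : ℕ) : N.interior n ⊆ N.ball n := fun _ hx => le_of_lt hx.1

instance finiteDimensional_testSpace (n : ℕ) : FiniteDimensional ℂ (N.testSpace n) :=
  FiniteDimensional.span_of_finite ℂ
    (((N.ball_finite n).subset (N.interior_subset_ball n)).image _)

theorem testSpace_mono : Monotone N.testSpace := fun _ _ h =>
  Submodule.span_mono (Set.image_mono fun _ hx => ⟨hx.1.trans_le h, hx.2⟩)

variable {N} {lam : ℂ} {n : ℕ} {φ : V →₀ ℂ}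

theorem mem_testSpace {u : N.EdgeSpace} :
    u ∈ N.testSpace n ↔ ∃ φ ∈ Finsupp.supported ℂ ℂ (N.interior n), N.grad φ = u :=
  Finsupp.mem_span_image_iff_linearCombination ℂ

theorem mem_interior_iff {x : N.ball n} :
    (x : V) ∈ N.interior n ↔ x ∉ N.partialGround n ∧ x ≠ ⟨N.a, N.a_mem_ball n⟩ := by
  have hx : N.graph.dist N.a x ≤ n := x.2
  rw [Ne, Subtype.ext_iff]
  simp only [interior, partialGround, sphere, Set.mem_ofPred_eq, Set.mem_union, not_or,
    hx.lt_iff_ne]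
  tauto

theorem a_notMem_partialGround (hn : 1 ≤ n) :
    (⟨N.a, N.a_mem_ball n⟩ : N.ball n) ∉ N.partialGround n := by
  rintro (h | h)
  · exact N.a_notMem_B h
  · rw [sphere, Set.mem_ofPred_eq, SimpleGraph.dist_self] at h
    exact (Nat.one_le_iff_ne_zero.mp hn) h.symm

theorem sub_single_mem_supported_interior_iff (hn : 1 ≤ n)
    (hφ : φ ∈ Finsupp.supported ℂ ℂ (N.ball n)) :
    φ - Finsupp.single N.a 1 ∈ Finsupp.supported ℂ ℂ (N.interior n) ↔
      (∀ x ∈ N.partialGround n, φ (x : N.ball n) = 0) ∧ φ N.a = 1 := by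
  have haint : N.a ∉ N.interior n := fun h => h.2.1 rfl
  rw [Finsupp.mem_supported']
  constructor
  · refine fun h => ⟨fun x hx => ?_, ?_⟩
    · have hxa : (x : V) ≠ N.a := by
        intro hxa
        rw [show x = ⟨N.a, N.a_mem_ball n⟩ from Subtype.ext hxa] at hx
        exact a_notMem_partialGround hn hx
      simpa [hxa] using h x fun hint => (mem_interior_iff.mp hint).1 hx
    · simpa [sub_eq_zero] using h N.a haint
  · rintro ⟨hground, hsource⟩ x hx
    by_cases hxa : x = N.a
    · simp [hxa, hsource]
    rw [Finsupp.sub_apply, Finsupp.single_eq_of_ne hxa, sub_zero]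
    by_cases hxb : x ∈ N.ball n
    · refine hground ⟨x, hxb⟩ (by_contra fun hxg => hx ?_)
      exact mem_interior_iff (x := ⟨x, hxb⟩).mpr ⟨hxg, fun h => hxa (congrArg Subtype.val h)⟩
    · exact (Finsupp.mem_supported' ℂ φ).mp hφ x hxb

theorem laplacian_eq (h : lam ∈ N.coerciveSet) {x : N.ball n} (hx : N.graph.dist N.a x < n) :
    FiniteNetwork.laplacian (fun x y : N.ball n => N.admittance lam x y) (fun x => φ x) x =
      -(1 / 2) * ⟪N.gradSingle x, N.admittanceOp lam (N.grad φ)⟫_ℂ := by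
  rw [inner_gradSingle_admittanceOp_grad h hx, ← mul_assoc, Finset.mul_sum]
  exact Finset.sum_congr rfl fun y _ => by ring

theorem forall_mem_testSpace_inner_eq_zero_iff (h : lam ∈ N.coerciveSet) :
    (∀ u ∈ N.testSpace n, ⟪u, N.admittanceOp lam (N.grad φ)⟫_ℂ = 0) ↔
      ∀ x : N.ball n, x ∉ N.partialGround n → x ≠ ⟨N.a, N.a_mem_ball n⟩ →
        FiniteNetwork.laplacian (fun x y : N.ball n => N.admittance lam x y) (fun x => φ x) x =
          0 := by
  constructor
  · intro horth x hx hxa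
    have hint : (x : V) ∈ N.interior n := mem_interior_iff.mpr ⟨hx, hxa⟩
    rw [laplacian_eq h hint.1, horth _ (Submodule.subset_span ⟨x, hint, rfl⟩), mul_zero]
  · intro hharm
    refine fun u hu => (Submodule.mem_orthogonal _ _).mp ?_ u hu
    rw [← Submodule.span_singleton_le_iff_mem, ← Submodule.isOrtho_iff_le, Submodule.isOrtho_comm,
      testSpace, Submodule.isOrtho_span]
    rintro _ ⟨x, hx, rfl⟩ _ rfl
    obtain ⟨hxg, hxa⟩ := mem_interior_iff (x := ⟨x, N.interior_subset_ball n hx⟩).mp hx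
    have := hharm _ hxg hxa
    rw [laplacian_eq h hx.1] at this
    simpa using this

theorem isVoltage_iff (hn : 1 ≤ n) (h : lam ∈ N.coerciveSet)
    (hφ : φ ∈ Finsupp.supported ℂ ℂ (N.ball n)) :
    FiniteNetwork.IsVoltage (fun x y : N.ball n => N.admittance lam x y) ⟨N.a, N.a_mem_ball n⟩
        (N.partialGround n) (fun x => φ x) ↔
      φ - Finsupp.single N.a 1 ∈ Finsupp.supported ℂ ℂ (N.interior n) ∧
        ∀ u ∈ N.testSpace n, ⟪u, N.admittanceOp lam (N.grad φ)⟫_ℂ = 0 := by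
  rw [sub_single_mem_supported_interior_iff hn hφ, forall_mem_testSpace_inner_eq_zero_iff h]
  exact ⟨fun hv => ⟨⟨hv.ground, hv.source⟩, hv.harmonic⟩,
    fun ⟨⟨hground, hsource⟩, hharm⟩ => ⟨hharm, hground, hsource⟩⟩

theorem exists_isVoltage (hn : 1 ≤ n) (h : lam ∈ N.coerciveSet) :
    ∃ v, FiniteNetwork.IsVoltage (fun x y : N.ball n => N.admittance lam x y)
      ⟨N.a, N.a_mem_ball n⟩ (N.partialGround n) v := by
  obtain ⟨C, hC⟩ := exists_coerciveWith_admittanceOp h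
  have hsol := isGalerkinSolution_galerkinSolution (K := N.testSpace n) hC (N.gradSingle N.a)
  obtain ⟨ψ, hψ, hgrad⟩ := mem_testSpace.mp hsol.sub_mem
  have hball : ψ + Finsupp.single N.a 1 ∈ Finsupp.supported ℂ ℂ (N.ball n) :=
    add_mem (Finsupp.supported_mono (N.interior_subset_ball n) hψ)
      (Finsupp.single_mem_supported ℂ _ (N.a_mem_ball n))
  refine ⟨_, (isVoltage_iff hn h hball).mpr ⟨by rwa [add_sub_cancel_right], fun u hu => ?_⟩⟩
  rw [map_add, grad_single, hgrad, sub_add_cancel]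
  exact hsol.orthogonal u hu

theorem admittance_symm (lam : ℂ) (x y : V) : N.admittance lam x y = N.admittance lam y x := by
  classical
  rw [admittance, admittance, Sym2.eq_swap]
  exact if_congr (SimpleGraph.adj_comm _ _ _) rfl rfl

theorem current_eq (hn : 1 ≤ n) (h : lam ∈ N.coerciveSet) (ha : φ N.a = 1) :
    FiniteNetwork.current (fun x y : N.ball n => N.admittance lam x y) ⟨N.a, N.a_mem_ball n⟩
      (fun x => φ x) =
      1 / 2 * ⟪N.gradSingle N.a, N.admittanceOp lam (N.grad φ)⟫_ℂ := by
  have hdist : N.graph.dist N.a N.a < n := SimpleGraph.dist_self.trans_lt hn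
  rw [inner_gradSingle_admittanceOp_grad h hdist, ha, ← mul_assoc, one_div_mul_cancel two_ne_zero,
    one_mul, FiniteNetwork.current]
  simp only [admittance_symm lam _ N.a]

theorem current_of_isVoltage (hn : 1 ≤ n) (h : lam ∈ N.coerciveSet) {v : N.ball n → ℂ}
    (hv : FiniteNetwork.IsVoltage (fun x y : N.ball n => N.admittance lam x y)
      ⟨N.a, N.a_mem_ball n⟩ (N.partialGround n) v) :
    FiniteNetwork.current (fun x y : N.ball n => N.admittance lam x y) ⟨N.a, N.a_mem_ball n⟩ v =
      1 / 2 * response (N.testSpace n) (N.admittanceOp lam) (N.gradSingle N.a) := by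
  classical
  obtain ⟨C, hC⟩ := exists_coerciveWith_admittanceOp h
  obtain ⟨φ, hφ, rfl⟩ : ∃ φ ∈ Finsupp.supported ℂ ℂ (N.ball n), (fun x : N.ball n => φ x) = v := by
    refine ⟨(Finsupp.equivFunOnFinite.symm v).extendDomain,
      Finsupp.support_extendDomain_subset _, ?_⟩
    exact congrArg DFunLike.coe (Finsupp.subtypeDomain_extendDomain _)
  obtain ⟨hsub, horth⟩ := (isVoltage_iff hn h hφ).mp hv
  have hsol : IsGalerkinSolution (N.testSpace n) (N.admittanceOp lam) (N.gradSingle N.a)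
      (N.grad φ) :=
    ⟨mem_testSpace.mpr ⟨_, hsub, by rw [map_sub, grad_single]⟩, horth⟩
  rw [current_eq hn h hv.source, hsol.inner_eq_response hC]

theorem partialAdmittance_eq (hn : 1 ≤ n) (h : lam ∈ N.coerciveSet) :
    N.partialAdmittance n lam =
      ((1 / 2 * response (N.testSpace n) (N.admittanceOp lam) (N.gradSingle N.a) : ℂ) :
        OnePoint ℂ) := by
  have hex := exists_isVoltage hn h
  rw [partialAdmittance, FiniteNetwork.effectiveAdmittance, dif_pos hex,
    current_of_isVoltage hn h hex.choose_spec]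

end Voltage

section Limit

/-- The effective admittance of the infinite network. The closure of the union of the test spaces
consists of the gradients of the finite energy functions with zero boundary values; the factor
`1 / 2` makes up for the two orientations of each edge. -/
def limitAdmittance (lam : ℂ) : ℂ :=
  1 / 2 * response (⨆ n, N.testSpace n).topologicalClosure (N.admittanceOp lam) (N.gradSingle N.a)

theorem convergesHolomorphicallyOn {U : Set ℂ} (hU : U ⊆ N.coerciveSet) :
    N.ConvergesHolomorphicallyOn N.limitAdmittance U := by
  refine ⟨hU.trans coerciveSet_subset_admissible,
    ⟨fun n lam => 1 / 2 * response (N.testSpace n) (N.admittanceOp lam) (N.gradSingle N.a),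
      fun n hn lam hlam => partialAdmittance_eq hn (hU hlam), ?_⟩, fun lam hlam => ?_⟩
  · have hcont : ContinuousOn N.admittanceOp U := fun lam hlam =>
      (differentiableAt_admittanceOp (hU hlam)).continuousAt.continuousWithinAt
    exact (uniformContinuous_const_smul (1 / 2 : ℂ)).comp_tendstoLocallyUniformlyOn
      (tendstoLocallyUniformlyOn_response N.testSpace_mono hcont
        (fun lam hlam => exists_coerciveWith_admittanceOp (hU hlam)) (N.gradSingle N.a))
  · obtain ⟨C, hC⟩ := exists_coerciveWith_admittanceOp (hU hlam)
    exact ((differentiableAt_response (differentiableAt_admittanceOp (hU hlam)) hC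
      (N.gradSingle N.a)).const_mul (1 / 2)).differentiableWithinAt

end Limit

end InfiniteNetwork

end

theorem mainTheorem1_general {V : Type*} (N : InfiniteNetwork V) :
    ∃ P : ℂ → ℂ,
      N.ConvergesHolomorphicallyOn P {lam : ℂ | 0 < lam.re} ∧
      (∀ S : ℝ, (∀ e ∈ N.graph.edgeSet, N.D e ≤ S * N.L e) →
        N.ConvergesHolomorphicallyOn P {lam : ℂ | lam.im ≠ 0 ∧ S < ‖lam‖ ^ 2}) ∧
      (∀ S : ℝ, (∀ e ∈ N.graph.edgeSet, S * N.L e ≤ N.D e) →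
        N.ConvergesHolomorphicallyOn P {lam : ℂ | lam.im ≠ 0 ∧ ‖lam‖ ^ 2 < S}) :=
  ⟨N.limitAdmittance,
    N.convergesHolomorphicallyOn fun _ h => InfiniteNetwork.mem_coerciveSet_of_re_pos h,
    fun _ hS => N.convergesHolomorphicallyOn fun _ h =>
      InfiniteNetwork.mem_coerciveSet_of_lt_norm_sq hS h.1 h.2,
    fun _ hS => N.convergesHolomorphicallyOn fun _ h =>
      InfiniteNetwork.mem_coerciveSet_of_norm_sq_lt hS h.1 h.2⟩

theorem mainTheorem1 {V : Type*} (N : InfiniteNetwork V) :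
    ∃ P : ℂ → ℂ,
      N.ConvergesHolomorphicallyOn P {lam : ℂ | 0 < lam.re} ∧
      ((∀ e ∈ N.graph.edgeSet, 0 < N.L e) → BddAbove N.ratiosDL → BddAbove N.ratiosRL →
        N.ConvergesHolomorphicallyOn P {lam : ℂ | lam.im ≠ 0 ∧ sSup N.ratiosDL < ‖lam‖ ^ 2} ∧
        (0 < sInf N.ratiosDL →
          N.ConvergesHolomorphicallyOn P
            {lam : ℂ | lam.im ≠ 0 ∧ ‖lam‖ ^ 2 < sInf N.ratiosDL})) := by
  obtain ⟨P, hre, hsup, hinf⟩ := mainTheorem1_general N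
  exact ⟨P, hre, fun hL hD _ => ⟨hsup _ (InfiniteNetwork.D_le_sSup_ratiosDL_mul_L hL hD),
    fun _ => hinf _ (InfiniteNetwork.sInf_ratiosDL_mul_L_le_D hL)⟩⟩
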